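/- For integers $p,q$ let $\mathrm{BS}(p,q)=\langle a,t\mid ta^pt^{-1}=a^q\rangle$ denote the Baumslag–Solitar group. Regard $\mathrm{GL}(2,\mathbb{Z})$ as a subgroup of $\mathrm{GL}(2,\mathbb{Q})$, and let $G$ be a finitely generated group with $\mathrm{GL}(2,\mathbb{Z})\lneq G\leq \mathrm{GL}(2,\mathbb{Q})$. Then exactly one of the following two cases holds. 1. $G$ is isomorphic to $\mathrm{GL}(2,\mathbb{Z})\times\mathbb{Z}^k$ for some $k\geq 1$, and $G$ contains no subgroup isomorphic to $\mathrm{BS}(1,q)$ for any $q\geq 2$. 2. For some $q\geq 2$ there are subgroups $B\leq K\leq G$ such that $B$ is isomorphic to $\mathrm{BS}(1,q)$ and $B$ has infinite index in $K$. Moreover, if $G$ is isomorphic to $\mathrm{GL}(2,\mathbb{Z})\times\mathbb{Z}^k$ for some $k\geq 1$, then $G$ contains no subgroup isomorphic to $\mathrm{BS}(1,q)$ with $q\geq 2$; so the isomorphism in case 1 alone already excludes case 2. -/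

import Mathlib

/-- The single defining relator `t a^p t⁻¹ (a^q)⁻¹` of the Baumslag-Solitar group, in the free
group on two letters, with `a` the letter `0` and `t` the letter `1`. -/
def baumslagSolitarRelator (p q : ℤ) : FreeGroup (Fin 2) :=
  FreeGroup.of 1 * FreeGroup.of 0 ^ p * (FreeGroup.of 1)⁻¹ * (FreeGroup.of 0 ^ q)⁻¹

/-- The Baumslag-Solitar group `BS(p, q) = ⟨a, t | t a^p t⁻¹ = a^q⟩`. -/
abbrev BaumslagSolitar (p q : ℤ) : Type :=
  PresentedGroup ({baumslagSolitarRelator p q} : Set (FreeGroup (Fin 2)))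

/-- `GL(2, ℤ)` as a subgroup of `GL(2, ℚ)`: the matrices with integral entries whose inverse also
has integral entries. -/
def integralGL2 : Subgroup (Matrix.GeneralLinearGroup (Fin 2) ℚ) :=
  (Matrix.GeneralLinearGroup.map (n := Fin 2) (Int.castRingHom ℚ)).range

/-- `G` is isomorphic to `GL(2, ℤ) × ℤ^k` for some `k ≥ 1`. -/
def IsGL2ZTimesFreeAbelian (G : Subgroup (Matrix.GeneralLinearGroup (Fin 2) ℚ)) : Prop :=
  ∃ k : ℕ, 1 ≤ k ∧
    Nonempty (G ≃* Matrix.GeneralLinearGroup (Fin 2) ℤ × Multiplicative (Fin k → ℤ))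

/-- `G` contains a subgroup isomorphic to `BS(1, q)` for some `q ≥ 2`. -/
def ContainsBS (G : Subgroup (Matrix.GeneralLinearGroup (Fin 2) ℚ)) : Prop :=
  ∃ q : ℕ, 2 ≤ q ∧ ∃ B : Subgroup (Matrix.GeneralLinearGroup (Fin 2) ℚ),
    B ≤ G ∧ Nonempty (BaumslagSolitar 1 q ≃* B)

/-- `G` contains a subgroup `K` which is an extension (that is, an overgroup) of infinite index of
a copy `B` of `BS(1, q)`, for some `q ≥ 2`. -/
def ContainsInfiniteIndexExtensionOfBS
    (G : Subgroup (Matrix.GeneralLinearGroup (Fin 2) ℚ)) : Prop :=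
  ∃ q : ℕ, 2 ≤ q ∧ ∃ K B : Subgroup (Matrix.GeneralLinearGroup (Fin 2) ℚ),
    B ≤ K ∧ K ≤ G ∧ Nonempty (BaumslagSolitar 1 q ≃* B) ∧ ¬ B.IsFiniteRelIndex K

/-!
Multiplying `g ∈ G` by elements of `GL(2, ℤ)` on both sides brings it to the Smith normal form
`diag(x, x * d)` with `x > 0` and `d ≥ 1` an integer, and `d = 1` exactly when `g` is a scalar
multiple of an element of `GL(2, ℤ)`.

If `d ≥ 2` for some `g`, then `diag(x, x * d)⁻¹` and `(1 1; 0 1)` generate a copy of `BS(1, d)` in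
`G`. It fixes the point `∞` of the projective line, whereas no positive power of `(1 0; 1 1)`
does, so its index in `G` is infinite. Otherwise `G ≤ GL(2, ℤ) × ℚ_{>0}`, where the second factor
is the group of positive scalars; since `G` contains the first factor, `G ≅ GL(2, ℤ) × Λ` with `Λ`
a finitely generated subgroup of `ℚ_{>0}`, hence free abelian.

To exclude `BS(1, q)` from `GL(n, ℤ) × A` with `A` abelian, let `t g t⁻¹ = g ^ q` in `GL(n, ℤ)`.
Some power `b = g ^ m` with `m ≥ 1` is congruent to `1` modulo `q`, so `b ^ q ^ k` is congruent to
`1` modulo `q ^ (k + 1)`, and so is its conjugate `b`. As `k` is arbitrary, `b = 1`; but `a` has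
infinite order in `BS(1, q)`.
-/

section Semiconj

variable {H : Type*} [Group H] {a t : H} {q : ℤ}

lemma semiconjBy_pow_zpow (h : SemiconjBy t a (a ^ q)) (i : ℕ) (k : ℤ) :
    SemiconjBy (t ^ i) (a ^ k) (a ^ (q ^ i * k)) := by
  induction i with
  | zero => simp
  | succ i ih =>
    have hstep : SemiconjBy t (a ^ (q ^ i * k)) (a ^ (q ^ (i + 1) * k)) := by
      simpa only [← zpow_mul, ← mul_assoc, ← pow_succ'] using h.zpow_right (q ^ i * k)
    rw [pow_succ' t]
    exact hstep.mul_left ih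

lemma eq_zero_of_commute_zpow_of_semiconjBy (h : SemiconjBy t a (a ^ q)) (ha : ¬ IsOfFinOrder a)
    (hq : q ≠ 1) {k : ℤ} (hk : Commute t (a ^ k)) : k = 0 := by
  have hconj : SemiconjBy t (a ^ k) (a ^ (q * k)) := by
    simpa using semiconjBy_pow_zpow h 1 k
  have hpow : a ^ (q * k) = a ^ k := mul_right_cancel (hconj.eq.symm.trans hk.eq)
  have hqk : q * k = k := injective_zpow_iff_not_isOfFinOrder.mpr ha hpow
  by_contra hk0
  exact hq ((mul_eq_right₀ hk0).mp hqk)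

lemma pow_left_injective_of_semiconjBy_zpow (h : SemiconjBy t a (a ^ q)) (ha : ¬ IsOfFinOrder a)
    (hq : 1 < q.natAbs) : Function.Injective (fun i : ℕ ↦ t ^ i) := by
  intro i j hij
  have hconj (n : ℕ) : SemiconjBy (t ^ n) a (a ^ q ^ n) := by
    simpa using semiconjBy_pow_zpow h n 1
  have hpow : a ^ q ^ i = a ^ q ^ j := by
    have hi : t ^ j * a = a ^ q ^ i * t ^ j := by
      simpa only [show t ^ i = t ^ j from hij] using (hconj i).eq
    exact mul_right_cancel (hi.symm.trans (hconj j).eq)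
  exact Int.pow_right_injective hq (injective_zpow_iff_not_isOfFinOrder.mpr ha hpow)

end Semiconj

namespace BaumslagSolitar

variable {p q : ℤ}

/-- The generator `a` of `BS(p, q)`. -/
abbrev a (p q : ℤ) : BaumslagSolitar p q := PresentedGroup.of 0

/-- The stable letter `t` of `BS(p, q)`. -/
abbrev t (p q : ℤ) : BaumslagSolitar p q := PresentedGroup.of 1

lemma semiconjBy_t (p q : ℤ) : SemiconjBy (t p q) (a p q ^ p) (a p q ^ q) := by
  have hrel : t p q * a p q ^ p * (t p q)⁻¹ * (a p q ^ q)⁻¹ = 1 :=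
    PresentedGroup.one_of_mem (Set.mem_singleton (baumslagSolitarRelator p q))
  exact mul_inv_eq_iff_eq_mul.mp (mul_inv_eq_one.mp hrel)

lemma mem_of_a_mem_of_t_mem {S : Subgroup (BaumslagSolitar p q)} (ha : a p q ∈ S)
    (ht : t p q ∈ S) (x : BaumslagSolitar p q) : x ∈ S :=
  PresentedGroup.generated_by _ S (Fin.forall_fin_two.mpr ⟨ha, ht⟩) x

lemma exists_pow_mul_eq_zpow_mul_pow (x : BaumslagSolitar 1 q) :
    ∃ (i j : ℕ) (k : ℤ), t 1 q ^ i * x = a 1 q ^ k * t 1 q ^ j := by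
  have hta : SemiconjBy (t 1 q) (a 1 q) (a 1 q ^ q) := by simpa using semiconjBy_t 1 q
  have hx : x ∈ Subgroup.closure {a 1 q, t 1 q} :=
    mem_of_a_mem_of_t_mem (Subgroup.subset_closure (by simp)) (Subgroup.subset_closure (by simp)) x
  have a_zpow_mul {y : BaumslagSolitar 1 q} (ε : ℤ) {i j : ℕ} {k : ℤ}
      (hy : t 1 q ^ i * y = a 1 q ^ k * t 1 q ^ j) :
      t 1 q ^ i * (a 1 q ^ ε * y) = a 1 q ^ (q ^ i * ε + k) * t 1 q ^ j := by
    rw [← mul_assoc, (semiconjBy_pow_zpow hta i ε).eq, mul_assoc, hy, zpow_add, mul_assoc]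
  induction hx using Subgroup.closure_induction_left with
  | one => exact ⟨0, 0, 0, by simp⟩
  | mul_left s hs y _ ih =>
    obtain ⟨i, j, k, hy⟩ := ih
    obtain rfl | rfl := hs
    · exact ⟨i, j, _, by simpa using a_zpow_mul 1 hy⟩
    · refine ⟨i, j + 1, q * k, ?_⟩
      calc t 1 q ^ i * (t 1 q * y) = t 1 q * (t 1 q ^ i * y) := by
            rw [← mul_assoc, ← pow_succ, pow_succ', mul_assoc]
        _ = t 1 q * a 1 q ^ k * t 1 q ^ j := by rw [hy, mul_assoc]
        _ = a 1 q ^ (q * k) * t 1 q ^ (j + 1) := by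
            rw [zpow_mul, (hta.zpow_right k).eq, pow_succ', mul_assoc]
  | inv_mul_cancel s hs y _ ih =>
    obtain ⟨i, j, k, hy⟩ := ih
    obtain rfl | rfl := hs
    · exact ⟨i, j, _, by simpa using a_zpow_mul (-1) hy⟩
    · exact ⟨i + 1, j, k, by rw [pow_succ, mul_assoc, mul_inv_cancel_left, hy]⟩

variable {H : Type*} [Group H] {α τ : H}

/-- The homomorphism from `BS(p, q)` determined by the images of the generators. -/
def lift (h : SemiconjBy τ (α ^ p) (α ^ q)) : BaumslagSolitar p q →* H :=
  PresentedGroup.toGroup (f := ![α, τ]) <| by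
    rintro _ rfl
    simp [baumslagSolitarRelator, h.eq]

@[simp] lemma lift_a (h : SemiconjBy τ (α ^ p) (α ^ q)) : lift h (a p q) = α :=
  PresentedGroup.toGroup.of _

@[simp] lemma lift_t (h : SemiconjBy τ (α ^ p) (α ^ q)) : lift h (t p q) = τ :=
  PresentedGroup.toGroup.of _

lemma range_lift_le (h : SemiconjBy τ (α ^ p) (α ^ q)) {S : Subgroup H} (hα : α ∈ S)
    (hτ : τ ∈ S) : (lift h).range ≤ S := by
  rintro _ ⟨x, rfl⟩
  exact mem_of_a_mem_of_t_mem (S := S.comap (lift h)) (by simpa using hα) (by simpa using hτ) x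

theorem lift_injective (h : SemiconjBy τ (α ^ (1 : ℤ)) (α ^ q)) (hq : 1 < q.natAbs)
    (hα : ¬ IsOfFinOrder α) : Function.Injective (lift h) := by
  have hτα : SemiconjBy τ α (α ^ q) := by simpa using h
  rw [injective_iff_map_eq_one]
  intro x hx
  obtain ⟨i, j, k, hnf⟩ := exists_pow_mul_eq_zpow_mul_pow x
  have himage : τ ^ i = α ^ k * τ ^ j := by
    simpa [hx] using congrArg (lift h) hnf
  have hcomm : Commute τ (α ^ k) := by
    rw [eq_mul_inv_of_mul_eq himage.symm]
    exact (Commute.self_pow τ i).mul_right (Commute.self_pow τ j).inv_right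
  obtain rfl : k = 0 :=
    eq_zero_of_commute_zpow_of_semiconjBy hτα hα (by rintro rfl; simp at hq) hcomm
  obtain rfl : i = j := pow_left_injective_of_semiconjBy_zpow hτα hα hq (by simpa using himage)
  simpa using hnf

end BaumslagSolitar

section CongruenceModPowers

variable {A : Type*} [Ring A] {q : ℕ}

lemma natCast_pow_dvd_pow_pow_sub_one {b : A} (h : (q : A) ∣ b - 1) (k : ℕ) :
    (q : A) ^ (k + 1) ∣ b ^ q ^ k - 1 := by
  obtain ⟨c, hc⟩ := h
  -- `b = 1 + q c` is the value at `X = c` of a polynomial over the commutative ring `ℤ`.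
  have hpoly : (q : Polynomial ℤ) ^ (k + 1) ∣
      (1 + (q : Polynomial ℤ) * Polynomial.X) ^ q ^ k - 1 ^ q ^ k :=
    dvd_sub_pow_of_dvd_sub ⟨Polynomial.X, by ring⟩ k
  simpa [← hc] using map_dvd (Polynomial.aeval c) hpoly

lemma natCast_pow_dvd_sub_one_of_semiconjBy {b t : Aˣ} (h : SemiconjBy t b (b ^ q))
    (hb : (q : A) ∣ b - 1) (k : ℕ) : (q : A) ^ (k + 1) ∣ (b : A) - 1 := by
  have hconj : SemiconjBy (t ^ k) b (b ^ q ^ k) := by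
    have hz : SemiconjBy t b (b ^ (q : ℤ)) := by rwa [zpow_natCast]
    have hk := semiconjBy_pow_zpow hz k 1
    rw [zpow_one, mul_one] at hk
    exact_mod_cast hk
  have hb' : b = (t ^ k)⁻¹ * b ^ q ^ k * t ^ k := by
    rw [mul_assoc, eq_inv_mul_iff_mul_eq, hconj.eq]
  obtain ⟨c, hc⟩ := natCast_pow_dvd_pow_pow_sub_one hb k
  have hcomm : Commute ((q : A) ^ (k + 1)) ↑(t ^ k)⁻¹ := (Nat.cast_commute q _).pow_left _
  refine ⟨↑(t ^ k)⁻¹ * c * ↑(t ^ k), ?_⟩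
  calc (b : A) - 1 = ↑((t ^ k)⁻¹ * b ^ q ^ k * t ^ k) - 1 := by rw [← hb']
    _ = ↑(t ^ k)⁻¹ * ((b : A) ^ q ^ k - 1) * ↑(t ^ k) := by
        rw [mul_sub, sub_mul, mul_one, Units.inv_mul, Units.val_mul, Units.val_mul,
          Units.val_pow_eq_pow_val b]
    _ = (q : A) ^ (k + 1) * (↑(t ^ k)⁻¹ * c * ↑(t ^ k)) := by
        rw [hc, ← mul_assoc, ← hcomm.eq, mul_assoc, mul_assoc, mul_assoc]

end CongruenceModPowers

open Matrix
open scoped OnePoint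

section UpperTriangular

variable {R : Type*} [CommRing R]

open GeneralLinearGroup

lemma isOfFinOrder_upperRightHom_iff {r : R} :
    IsOfFinOrder (upperRightHom r) ↔ IsOfFinAddOrder r := by
  simp only [isOfFinOrder_iff_pow_eq_one, isOfFinAddOrder_iff_nsmul_eq_zero,
    ← AddChar.map_nsmul_eq_pow, ← AddChar.map_zero_eq_one (upperRightHom (R := R)),
    injective_upperRightHom.eq_iff]

lemma semiconjBy_upperRightHom_of_eq_diagonal {D : GL (Fin 2) R} {x y r s : R}
    (hD : D.val = !![x, 0; 0, y]) (h : x * r = s * y) :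
    SemiconjBy D (upperRightHom r) (upperRightHom s) := by
  refine Units.ext ?_
  simp [hD, h]

lemma upperRightHom_one_zpow (k : ℤ) : upperRightHom (1 : R) ^ k = upperRightHom (k : R) := by
  rw [← AddChar.map_zsmul_eq_zpow, zsmul_one]

end UpperTriangular

lemma BaumslagSolitar.not_isOfFinOrder_a {p q : ℤ} (hp : p ≠ 0) (hq : q ≠ 0) :
    ¬ IsOfFinOrder (BaumslagSolitar.a p q) := by
  let D : GL (Fin 2) ℚ := .mkOfDetNeZero !![(q : ℚ), 0; 0, (p : ℚ)] (by simp [hp, hq])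
  have hD : SemiconjBy D (GeneralLinearGroup.upperRightHom (1 : ℚ) ^ p)
      (GeneralLinearGroup.upperRightHom (1 : ℚ) ^ q) := by
    simp only [upperRightHom_one_zpow]
    exact semiconjBy_upperRightHom_of_eq_diagonal rfl rfl
  intro h
  have himage := (BaumslagSolitar.lift hD).isOfFinOrder h
  rw [BaumslagSolitar.lift_a, isOfFinOrder_upperRightHom_iff] at himage
  exact not_isOfFinAddOrder_of_isAddTorsionFree one_ne_zero himage

section IntegralMatrices

variable {n : Type*} [Fintype n] [DecidableEq n] {q : ℕ}

lemma eq_zero_of_forall_natCast_pow_dvd (hq : 1 < q) {M : Matrix n n ℤ}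
    (h : ∀ k : ℕ, (q : Matrix n n ℤ) ^ (k + 1) ∣ M) : M = 0 := by
  ext i j
  obtain ⟨N, hN⟩ := h (M i j).natAbs
  refine Int.eq_zero_of_abs_lt_dvd (m := (q : ℤ) ^ ((M i j).natAbs + 1)) ⟨N i j, ?_⟩ ?_
  · conv_lhs => rw [hN]
    rw [← Nat.cast_pow, ← Nat.cast_pow, ← nsmul_eq_mul, Matrix.smul_apply, nsmul_eq_mul]
  · rw [Int.abs_eq_natAbs]
    exact_mod_cast (Nat.lt_succ_self _).trans (Nat.lt_pow_self hq)

lemma exists_pow_natCast_dvd_sub_one (hq : q ≠ 0) (g : GL n ℤ) :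
    ∃ m : ℕ, 0 < m ∧ (q : Matrix n n ℤ) ∣ (g ^ m).val - 1 := by
  have : NeZero q := ⟨hq⟩
  obtain ⟨m, hm, hgm⟩ := isOfFinOrder_iff_pow_eq_one.mp
    (isOfFinOrder_of_finite (GeneralLinearGroup.map (n := n) (Int.castRingHom (ZMod q)) g))
  have hmod : (Int.castRingHom (ZMod q)).mapMatrix ((g ^ m).val - 1) = 0 := by
    rw [← map_pow] at hgm
    rw [map_sub, map_one, sub_eq_zero]
    exact congrArg Units.val hgm
  have hentry (i j : n) : (q : ℤ) ∣ ((g ^ m).val - 1) i j :=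
    (ZMod.intCast_zmod_eq_zero_iff_dvd _ _).mp (congrFun₂ hmod i j)
  choose N hN using hentry
  refine ⟨m, hm, .of N, ?_⟩
  ext i j
  rw [hN, ← nsmul_eq_mul (q : ℕ) (of N), Matrix.smul_apply, of_apply, nsmul_eq_mul]

theorem isOfFinOrder_of_semiconjBy_pow (hq : 1 < q) {g t : GL n ℤ} (h : SemiconjBy t g (g ^ q)) :
    IsOfFinOrder g := by
  obtain ⟨m, hm, hgm⟩ := exists_pow_natCast_dvd_sub_one (q := q) (by lia) g
  have hm' : SemiconjBy t (g ^ m) ((g ^ m) ^ q) := by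
    rw [pow_right_comm]
    exact h.pow_right m
  refine isOfFinOrder_iff_pow_eq_one.mpr ⟨m, hm, Units.ext (sub_eq_zero.mp ?_)⟩
  exact eq_zero_of_forall_natCast_pow_dvd hq (natCast_pow_dvd_sub_one_of_semiconjBy hm' hgm)

end IntegralMatrices

theorem BaumslagSolitar.not_injective_of_prod {n A : Type*} [Fintype n] [DecidableEq n]
    [CommGroup A] {q : ℕ} (hq : 1 < q) (φ : BaumslagSolitar 1 q →* GL n ℤ × A) :
    ¬ Function.Injective φ := by
  intro hφ
  have hrel : SemiconjBy (φ (t 1 q)) (φ (a 1 q)) (φ (a 1 q) ^ q) := by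
    have := (semiconjBy_t 1 (q : ℤ)).map φ
    simpa using this
  have hfst : IsOfFinOrder (φ (a 1 q)).1 :=
    isOfFinOrder_of_semiconjBy_pow hq (hrel.map (MonoidHom.fst _ _))
  have hsnd : IsOfFinOrder (φ (a 1 q)).2 := by
    have hconj := hrel.map (MonoidHom.snd (GL n ℤ) A)
    have hpow : (φ (a 1 q)).2 ^ 1 = (φ (a 1 q)).2 ^ q := by
      simpa using mul_left_cancel (hconj.eq.trans (mul_comm _ _))
    by_contra hinf
    exact hq.ne (injective_pow_iff_not_isOfFinOrder.mpr hinf hpow)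
  have : IsOfFinOrder (φ (a 1 q)) := hfst.prod_mk hsnd
  exact not_isOfFinOrder_a one_ne_zero (by positivity) (hφ.isOfFinOrder_iff.mp this)

lemma IsGL2ZTimesFreeAbelian.not_containsBS {G : Subgroup (GL (Fin 2) ℚ)}
    (hG : IsGL2ZTimesFreeAbelian G) : ¬ ContainsBS G := by
  obtain ⟨k, -, ⟨e⟩⟩ := hG
  rintro ⟨q, hq, B, hBG, ⟨f⟩⟩
  let φ := e.toMonoidHom.comp ((Subgroup.inclusion hBG).comp f.toMonoidHom)
  exact BaumslagSolitar.not_injective_of_prod hq φ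
    (e.injective.comp ((Subgroup.inclusion_injective hBG).comp f.injective))

section SmithNormalForm

variable {R : Type*} [CommRing R]

/-- The matrix `N` has a *minimal corner* if its upper left entry is minimal for divisibility among
the upper left entries of the matrices `u * N * v` with `u`, `v` invertible. A matrix with a minimal
corner is one step away from its Smith normal form. -/
def HasMinimalCorner (N : Matrix (Fin 2) (Fin 2) R) : Prop :=
  ∀ u v : Matrix (Fin 2) (Fin 2) R, IsUnit u.det → IsUnit v.det →
    (u * N * v) 0 0 ∣ N 0 0 → N 0 0 ∣ (u * N * v) 0 0

namespace HasMinimalCorner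

variable {N : Matrix (Fin 2) (Fin 2) R}

lemma transpose (hN : HasMinimalCorner N) : HasMinimalCorner Nᵀ := by
  intro u v hu hv
  have huv : u * Nᵀ * v = (vᵀ * N * uᵀ)ᵀ := by
    simp only [transpose_mul, transpose_transpose, mul_assoc]
  rw [huv]
  exact hN vᵀ uᵀ (by rwa [det_transpose]) (by rwa [det_transpose])

lemma mul_left (hN : HasMinimalCorner N) {w : Matrix (Fin 2) (Fin 2) R} (hw : IsUnit w.det)
    (hcorner : (w * N) 0 0 = N 0 0) : HasMinimalCorner (w * N) := by
  intro u v hu hv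
  rw [hcorner, ← mul_assoc]
  exact hN (u * w) v (by rw [det_mul]; exact hu.mul hw) hv

end HasMinimalCorner

lemma exists_hasMinimalCorner [WfDvdMonoid R] (M : Matrix (Fin 2) (Fin 2) R) :
    ∃ u v : Matrix (Fin 2) (Fin 2) R,
      IsUnit u.det ∧ IsUnit v.det ∧ HasMinimalCorner (u * M * v) := by
  obtain ⟨_, ⟨u, v, hu, hv, rfl⟩, hmin⟩ := (wellFounded_dvdNotUnit (α := R)).has_min
    {x | ∃ u v : Matrix (Fin 2) (Fin 2) R, IsUnit u.det ∧ IsUnit v.det ∧ (u * M * v) 0 0 = x}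
    ⟨_, 1, 1, by simp, by simp, rfl⟩
  refine ⟨u, v, hu, hv, fun u' v' hu' hv' hdvd ↦ ?_⟩
  by_contra hndvd
  refine hmin _ ⟨u' * u, v * v', ?_, ?_, ?_⟩ (dvdNotUnit_of_dvd_of_not_dvd hdvd hndvd)
  · rw [det_mul]; exact hu'.mul hu
  · rw [det_mul]; exact hv.mul hv'
  · simp only [mul_assoc]

variable [IsDomain R]

lemma exists_det_eq_one_and_mul_add_mul_dvd [IsBezout R] (x y : R) :
    ∃ v : Matrix (Fin 2) (Fin 2) R, v.det = 1 ∧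
      x * v 0 0 + y * v 1 0 ∣ x ∧ x * v 0 0 + y * v 1 0 ∣ y := by
  classical
  let := IsBezout.toGCDDomain R
  obtain ⟨x', y', hx, hy, hunit⟩ := extract_gcd x y
  obtain ⟨r, s, hrs⟩ := (gcd_isUnit_iff x' y').mp hunit
  have hgcd : x * r + y * s = gcd x y := by
    linear_combination r * hx + s * hy + gcd x y * hrs
  refine ⟨!![r, -y'; s, x'], by rw [det_fin_two_of, ← hrs]; ring, ?_⟩
  change x * r + y * s ∣ x ∧ x * r + y * s ∣ y
  rw [hgcd]
  exact ⟨gcd_dvd_left x y, gcd_dvd_right x y⟩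

namespace HasMinimalCorner

variable [IsBezout R] {N : Matrix (Fin 2) (Fin 2) R}

lemma dvd_zero_one (hN : HasMinimalCorner N) : N 0 0 ∣ N 0 1 := by
  obtain ⟨v, hv, hdvd₀, hdvd₁⟩ := exists_det_eq_one_and_mul_add_mul_dvd (N 0 0) (N 0 1)
  have hcorner : ((1 : Matrix (Fin 2) (Fin 2) R) * N * v) 0 0 = N 0 0 * v 0 0 + N 0 1 * v 1 0 := by
    rw [one_mul, mul_apply, Fin.sum_univ_two]
  rw [← hcorner] at hdvd₀ hdvd₁
  exact (hN 1 v (by simp) (by simp [hv]) hdvd₀).trans hdvd₁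

lemma dvd_one_zero (hN : HasMinimalCorner N) : N 0 0 ∣ N 1 0 :=
  hN.transpose.dvd_zero_one

lemma dvd_one_one (hN : HasMinimalCorner N) : N 0 0 ∣ N 1 1 := by
  obtain ⟨l, hl⟩ := hN.dvd_one_zero
  have hw : IsUnit (!![1 - l, 1; -l, 1] : Matrix (Fin 2) (Fin 2) R).det := by simp [det_fin_two]
  have hw₀ : (!![1 - l, 1; -l, 1] * N) 0 0 = N 0 0 := by
    rw [mul_apply, Fin.sum_univ_two, hl]
    change (1 - l) * N 0 0 + 1 * (N 0 0 * l) = N 0 0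
    ring
  have hw₁ : (!![1 - l, 1; -l, 1] * N) 0 1 = (1 - l) * N 0 1 + N 1 1 := by
    rw [mul_apply, Fin.sum_univ_two]
    simp
  have hdvd := (hN.mul_left hw hw₀).dvd_zero_one
  rw [hw₀, hw₁] at hdvd
  exact (dvd_add_right (hN.dvd_zero_one.mul_left _)).mp hdvd

end HasMinimalCorner

theorem exists_mul_mul_eq_diagonal [IsPrincipalIdealRing R] (M : Matrix (Fin 2) (Fin 2) R) :
    ∃ (u v : Matrix (Fin 2) (Fin 2) R) (x d : R), IsUnit u.det ∧ IsUnit v.det ∧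
      u * M * v = !![x, 0; 0, x * d] := by
  obtain ⟨u, v, hu, hv, hN⟩ := exists_hasMinimalCorner M
  set N := u * M * v with hNdef
  obtain ⟨k, hk⟩ := hN.dvd_zero_one
  obtain ⟨l, hl⟩ := hN.dvd_one_zero
  obtain ⟨m, hm⟩ := hN.dvd_one_one
  refine ⟨!![1, 0; -l, 1] * u, v * !![1, -k; 0, 1], N 0 0, m - l * k, ?_, ?_, ?_⟩
  · rw [det_mul]; simpa using hu
  · rw [det_mul]; simpa using hv
  calc !![1, 0; -l, 1] * u * M * (v * !![1, -k; 0, 1])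
      = !![1, 0; -l, 1] * N * !![1, -k; 0, 1] := by simp only [hNdef, mul_assoc]
    _ = !![N 0 0, 0; 0, N 0 0 * (m - l * k)] := by
        conv_lhs => rw [eta_fin_two N, hk, hl, hm, mul_fin_two, mul_fin_two]
        congrm !![?_, ?_; ?_, ?_] <;> ring

end SmithNormalForm

theorem exists_mul_mul_eq_diagonal_natCast (M : Matrix (Fin 2) (Fin 2) ℤ) :
    ∃ (u v : Matrix (Fin 2) (Fin 2) ℤ) (x d : ℕ), IsUnit u.det ∧ IsUnit v.det ∧
      u * M * v = !![(x : ℤ), 0; 0, x * d] := by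
  obtain ⟨u, v, x, d, hu, hv, huv⟩ := exists_mul_mul_eq_diagonal M
  obtain ⟨ε, hε⟩ := Int.associated_natAbs x
  obtain ⟨δ, hδ⟩ := Int.associated_natAbs d
  refine ⟨u, v * !![(ε : ℤ), 0; 0, ε * δ], x.natAbs, d.natAbs, hu, ?_, ?_⟩
  · simpa [det_fin_two] using hv
  · rw [← mul_assoc, huv, ← hε, ← hδ]
    rw [mul_fin_two]
    congrm !![?_, ?_; ?_, ?_] <;> ring

lemma exists_mem_integralGL2_mul_mul_eq_diagonal (g : GL (Fin 2) ℚ) :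
    ∃ U ∈ integralGL2, ∃ V ∈ integralGL2, ∃ (x : ℚ) (d : ℕ), 0 ≤ x ∧
      (U * g * V).val = !![x, 0; 0, x * d] := by
  obtain ⟨u, v, x, d, hu, hv, huv⟩ := exists_mul_mul_eq_diagonal_natCast g.val.num
  refine ⟨_, ⟨GeneralLinearGroup.mk'' u hu, rfl⟩, _, ⟨GeneralLinearGroup.mk'' v hv, rfl⟩,
    (g.val.den : ℚ)⁻¹ * x, d, by positivity, ?_⟩
  calc u.map (Int.cast : ℤ → ℚ) * g.val * v.map (Int.cast : ℤ → ℚ)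
      = (g.val.den : ℚ)⁻¹ • (u * g.val.num * v).map (Int.cast : ℤ → ℚ) := by
        conv_lhs => rw [← g.val.inv_denom_smul_num]
        rw [Matrix.map_mul_intCast, Matrix.map_mul_intCast, mul_smul_comm, smul_mul_assoc]
    _ = !![(g.val.den : ℚ)⁻¹ * x, 0; 0, (g.val.den : ℚ)⁻¹ * x * d] := by
        rw [huv]
        ext i j
        fin_cases i <;> fin_cases j <;> simp [mul_assoc]

section SubgroupOfProduct

variable {A B H : Type*} [Group A] [Group B] [Group H] {f : A × B →* H} {G : Subgroup H}

lemma apply_mem_iff_of_range_comp_inl_le (hG : (f.comp (.inl A B)).range ≤ G) (a : A) (b : B) :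
    f (a, b) ∈ G ↔ b ∈ G.comap (f.comp (.inr A B)) := by
  have ha : f (a, 1) ∈ G := hG ⟨a, rfl⟩
  rw [← Prod.fst_mul_snd (a, b), map_mul, Subgroup.mul_mem_cancel_left G ha]
  rfl

lemma nonempty_prod_comap_inr_mulEquiv (hf : Function.Injective f)
    (hinl : (f.comp (.inl A B)).range ≤ G) (hG : G ≤ f.range) :
    Nonempty (A × G.comap (f.comp (.inr A B)) ≃* G) := by
  let φ := f.comp ((MonoidHom.id A).prodMap (G.comap (f.comp (.inr A B))).subtype)
  have hφ : Function.Injective φ :=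
    hf.comp (Function.injective_id.prodMap (Subgroup.subtype_injective _))
  have hrange : φ.range = G := by
    refine le_antisymm ?_ fun g hg ↦ ?_
    · rintro _ ⟨⟨a, b⟩, rfl⟩
      exact (apply_mem_iff_of_range_comp_inl_le hinl a b).mpr b.2
    · obtain ⟨⟨a, b⟩, rfl⟩ := hG hg
      exact ⟨(a, ⟨b, (apply_mem_iff_of_range_comp_inl_le hinl a b).mp hg⟩), rfl⟩
  exact ⟨(MonoidHom.ofInjective hφ).trans (.subgroupCongr hrange)⟩

lemma nontrivial_comap_inr (hinl : (f.comp (.inl A B)).range < G) (hG : G ≤ f.range) :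
    Nontrivial (G.comap (f.comp (.inr A B))) := by
  obtain ⟨g, hgG, hg⟩ := SetLike.exists_of_lt hinl
  obtain ⟨⟨a, b⟩, rfl⟩ := hG hgG
  refine (Subgroup.nontrivial_iff_exists_ne_one _).mpr
    ⟨b, (apply_mem_iff_of_range_comp_inl_le hinl.le a b).mp hgG, ?_⟩
  rintro rfl
  exact hg ⟨a, rfl⟩

end SubgroupOfProduct

lemma exists_nonempty_mulEquiv_multiplicative_fin_int (A : Type*) [CommGroup A] [Group.FG A]
    [IsMulTorsionFree A] : ∃ k : ℕ, Nonempty (A ≃* Multiplicative (Fin k → ℤ)) := by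
  have : Module.Finite ℤ (Additive A) := Module.Finite.iff_addGroup_fg.mpr inferInstance
  exact ⟨_, ⟨AddEquiv.toMultiplicativeRight (Module.finBasis ℤ (Additive A)).equivFun.toAddEquiv⟩⟩

instance {R : Type*} [Semiring R] [LinearOrder R] [IsStrictOrderedRing R] :
    IsMulTorsionFree (Units.posSubgroup R) where
  pow_left_injective k hk u v huv := by
    have hpow : (u.1 : R) ^ k = (v.1 : R) ^ k := by
      simpa using congrArg (fun w : Units.posSubgroup R ↦ (w.1 : R)) huv
    exact Subtype.ext (Units.ext ((pow_left_inj₀ u.2.le v.2.le hk).mp hpow))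

section ScaledIntegralMatrices

variable (n : Type*) [Fintype n] [DecidableEq n]

/-- The homomorphism `(m, c) ↦ m * c` from `GL(n, ℤ) × ℚ_{>0}` to `GL(n, ℚ)`, whose range consists
of the rational multiples of the invertible integral matrices. Restricting to positive scalars makes
it injective. -/
def integralMulPosScalar : GL n ℤ × Units.posSubgroup ℚ →* GL n ℚ :=
  MonoidHom.noncommCoprod (GeneralLinearGroup.map (Int.castRingHom ℚ))
    ((GeneralLinearGroup.scalar n).comp (Units.posSubgroup ℚ).subtype)
    fun m c ↦ (GeneralLinearGroup.scalar_commute (c : ℚˣ) (.map (Int.castRingHom ℚ) m)).symm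

variable {n}

lemma integralMulPosScalar_apply (m : GL n ℤ) (c : Units.posSubgroup ℚ) :
    integralMulPosScalar n (m, c) = .map (Int.castRingHom ℚ) m * GeneralLinearGroup.scalar n c :=
  rfl

lemma generalLinearGroup_map_intCast_injective :
    Function.Injective (GeneralLinearGroup.map (n := n) (Int.castRingHom ℚ)) :=
  Units.map_injective (Matrix.map_injective Int.cast_injective)

lemma integralMulPosScalar_injective [Nonempty n] :
    Function.Injective (integralMulPosScalar n) := by
  rw [injective_iff_map_eq_one]
  rintro ⟨m, c⟩ hmc
  have hdet := congrArg GeneralLinearGroup.det hmc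
  rw [integralMulPosScalar_apply, map_mul, GeneralLinearGroup.map_det,
    GeneralLinearGroup.det_scalar, map_one] at hdet
  have hpow : c ^ (Fintype.card n * 2) = 1 := by
    have hsq : (c : ℚˣ) ^ (Fintype.card n * 2) = 1 := by
      have := congrArg (· ^ 2) hdet
      rwa [mul_pow, ← map_pow, Int.units_sq, map_one, one_mul, one_pow, ← pow_mul] at this
    exact Subtype.ext hsq
  obtain rfl : c = 1 := (pow_eq_one_iff_left (by simp)).mp hpow
  have hm : GeneralLinearGroup.map (Int.castRingHom ℚ) m = 1 := by
    simpa [integralMulPosScalar_apply] using hmc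
  exact Prod.ext (generalLinearGroup_map_intCast_injective (hm.trans (map_one _).symm)) rfl

end ScaledIntegralMatrices

lemma range_integralMulPosScalar_comp_inl :
    ((integralMulPosScalar (Fin 2)).comp (.inl _ _)).range = integralGL2 :=
  congrArg MonoidHom.range (MonoidHom.noncommCoprod_comp_inl _ _ _)

theorem isGL2ZTimesFreeAbelian_of_le_range_integralMulPosScalar {G : Subgroup (GL (Fin 2) ℚ)}
    (hfg : G.FG) (hlt : integralGL2 < G) (hG : G ≤ (integralMulPosScalar (Fin 2)).range) :
    IsGL2ZTimesFreeAbelian G := by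
  rw [← range_integralMulPosScalar_comp_inl] at hlt
  let Λ := G.comap ((integralMulPosScalar (Fin 2)).comp (.inr _ _))
  obtain ⟨e⟩ : Nonempty (GL (Fin 2) ℤ × Λ ≃* G) :=
    nonempty_prod_comap_inr_mulEquiv integralMulPosScalar_injective hlt.le hG
  have : Nontrivial Λ := nontrivial_comap_inr hlt hG
  have : Group.FG G := (Group.fg_iff_subgroup_fg G).mpr hfg
  have : Group.FG Λ :=
    Group.fg_of_surjective (f := (MonoidHom.snd _ Λ).comp e.symm.toMonoidHom)
      (Prod.snd_surjective.comp e.symm.surjective)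
  obtain ⟨k, ⟨ε⟩⟩ := exists_nonempty_mulEquiv_multiplicative_fin_int Λ
  refine ⟨k, Nat.one_le_iff_ne_zero.mpr ?_, ⟨e.symm.trans ((MulEquiv.refl _).prodCongr ε)⟩⟩
  rintro rfl
  exact not_subsingleton Λ ε.toEquiv.subsingleton

lemma not_isFiniteRelIndex_stabilizer_infty_integralGL2 :
    ¬ (MulAction.stabilizer (GL (Fin 2) ℚ) (∞ : OnePoint ℚ)).IsFiniteRelIndex integralGL2 := by
  intro h
  let L : GL (Fin 2) ℤ := .mk'' !![1, 0; 1, 1] (by simp)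
  have hL (k : ℕ) : (L ^ k).val = !![1, 0; (k : ℤ), 1] := by
    induction k with
    | zero => simp [one_fin_two]
    | succ k ih =>
      rw [pow_succ, Units.val_mul, ih]
      simp [L]
  obtain ⟨k, hk, -, hmem, -⟩ :=
    Subgroup.exists_pow_mem_of_relIndex_ne_zero h.relIndex_ne_zero (a := .map _ L) ⟨L, rfl⟩
  rw [← map_pow] at hmem
  have hcorner : ((L ^ k).val 1 0 : ℚ) = 0 := OnePoint.smul_infty_eq_self_iff.mp hmem
  rw [hL] at hcorner
  exact hk.ne' (by simpa using hcorner)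

lemma containsInfiniteIndexExtensionOfBS_of_diagonal_mem {G : Subgroup (GL (Fin 2) ℚ)}
    (hG : integralGL2 ≤ G) {D : GL (Fin 2) ℚ} (hDG : D ∈ G) {x : ℚ} {d : ℕ} (hd : 2 ≤ d)
    (hD : D.val = !![x, 0; 0, x * d]) : ContainsInfiniteIndexExtensionOfBS G := by
  have hrel : SemiconjBy D⁻¹ (GeneralLinearGroup.upperRightHom (1 : ℚ) ^ (1 : ℤ))
      (GeneralLinearGroup.upperRightHom (1 : ℚ) ^ (d : ℤ)) := by
    rw [upperRightHom_one_zpow, upperRightHom_one_zpow]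
    exact (semiconjBy_upperRightHom_of_eq_diagonal hD (by push_cast; ring)).inv_symm_left
  have hmem : GeneralLinearGroup.upperRightHom (1 : ℚ) ∈ G := by
    refine hG ⟨GeneralLinearGroup.upperRightHom 1, ?_⟩
    ext i j
    fin_cases i <;> fin_cases j <;> simp
  have hinj : Function.Injective (BaumslagSolitar.lift hrel) := by
    refine BaumslagSolitar.lift_injective hrel (by rwa [Int.natAbs_natCast]) ?_
    rw [isOfFinOrder_upperRightHom_iff]
    exact not_isOfFinAddOrder_of_isAddTorsionFree one_ne_zero
  have hstab : (BaumslagSolitar.lift hrel).range ≤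
      MulAction.stabilizer (GL (Fin 2) ℚ) (∞ : OnePoint ℚ) := by
    refine BaumslagSolitar.range_lift_le hrel ?_ (inv_mem ?_) <;>
      simp [MulAction.mem_stabilizer_iff, OnePoint.smul_infty_eq_self_iff, hD]
  refine ⟨d, hd, G, _, BaumslagSolitar.range_lift_le hrel hmem (inv_mem hDG), le_rfl,
    ⟨MonoidHom.ofInjective hinj⟩, fun hfin ↦ ?_⟩
  have := Subgroup.isFiniteRelIndex_of_le_left G hstab
  exact not_isFiniteRelIndex_stabilizer_infty_integralGL2
    (Subgroup.isFiniteRelIndex_of_le_right _ hG)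

lemma mem_range_integralMulPosScalar_of_eq_scalar {D : GL (Fin 2) ℚ} {x : ℚ} (hx : 0 < x)
    (hD : D.val = !![x, 0; 0, x]) : D ∈ (integralMulPosScalar (Fin 2)).range := by
  refine ⟨(1, ⟨.mk0 x hx.ne', hx⟩), Units.ext ?_⟩
  rw [hD, integralMulPosScalar_apply, map_one, one_mul, GeneralLinearGroup.coe_scalar]
  ext i j
  fin_cases i <;> fin_cases j <;> simp

theorem containsInfiniteIndexExtensionOfBS_of_not_le_range_integralMulPosScalar
    {G : Subgroup (GL (Fin 2) ℚ)} (hG : integralGL2 ≤ G)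
    (hG' : ¬ G ≤ (integralMulPosScalar (Fin 2)).range) :
    ContainsInfiniteIndexExtensionOfBS G := by
  obtain ⟨g, hgG, hg⟩ := SetLike.not_le_iff_exists.mp hG'
  obtain ⟨U, hU, V, hV, x, d, hx, hD⟩ := exists_mem_integralGL2_mul_mul_eq_diagonal g
  have hrange : integralGL2 ≤ (integralMulPosScalar (Fin 2)).range := by
    rw [← range_integralMulPosScalar_comp_inl]
    exact (MonoidHom.range_comp _ _).trans_le (Subgroup.map_le_range _ _)
  have hdet : x * (x * d) ≠ 0 := by
    simpa [hD] using (U * g * V).det_ne_zero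
  have hx0 : x ≠ 0 := left_ne_zero_of_mul hdet
  have hd0 : d ≠ 0 := by rintro rfl; simp at hdet
  have hd1 : d ≠ 1 := by
    rintro rfl
    have hmem := mem_range_integralMulPosScalar_of_eq_scalar (hx.lt_of_ne' hx0) (hD.trans (by simp))
    rw [Subgroup.mul_mem_cancel_right _ (hrange hV),
      Subgroup.mul_mem_cancel_left _ (hrange hU)] at hmem
    exact hg hmem
  exact containsInfiniteIndexExtensionOfBS_of_diagonal_mem hG
    (mul_mem (mul_mem (hG hU) hgG) (hG hV)) (by lia) hD

lemma ContainsInfiniteIndexExtensionOfBS.containsBS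
    {G : Subgroup (Matrix.GeneralLinearGroup (Fin 2) ℚ)}
    (h : ContainsInfiniteIndexExtensionOfBS G) : ContainsBS G := by
  obtain ⟨q, hq, K, B, hBK, hKG, hB, -⟩ := h
  exact ⟨q, hq, B, hBK.trans hKG, hB⟩

theorem mainTheorem4 (G : Subgroup (Matrix.GeneralLinearGroup (Fin 2) ℚ)) (hfg : G.FG)
    (hlt : integralGL2 < G) :
    Xor (IsGL2ZTimesFreeAbelian G ∧ ¬ ContainsBS G) (ContainsInfiniteIndexExtensionOfBS G) ∧
      (IsGL2ZTimesFreeAbelian G → ¬ ContainsBS G) := by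
  refine ⟨?_, IsGL2ZTimesFreeAbelian.not_containsBS⟩
  by_cases hG : G ≤ (integralMulPosScalar (Fin 2)).range
  · have hprod := isGL2ZTimesFreeAbelian_of_le_range_integralMulPosScalar hfg hlt hG
    exact .inl ⟨⟨hprod, hprod.not_containsBS⟩, fun hBS ↦ hprod.not_containsBS hBS.containsBS⟩
  · have hBS := containsInfiniteIndexExtensionOfBS_of_not_le_range_integralMulPosScalar hlt.le hG
    exact .inr ⟨hBS, fun hprod ↦ hprod.2 hBS.containsBS⟩
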